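/- Let $G$ be a (discrete) group and $H\le G$ a subgroup. Let $\mathbf K$ be $\mathbf R$ or $\mathbf C$. We say that $H$ is \emph{co-amenable} in $G$ if every continuous affine $G$-action on a convex compact subset of a (Hausdorff) locally convex topological vector space which has an $H$-fixed point has a $G$-fixed point. A \emph{Banach $G$-module} is a Banach space $F$ over $\mathbf K$ with an action of $G$ by linear isometric automorphisms. A \emph{dual Banach $G$-module} is the normed dual $V=F^*$ of a Banach $G$-module $F$ with the contragredient action $(g\varphi)(x)=\varphi(g^{-1}x)$. For $n\ge 0$, the bounded cohomology ${\rm H}_{\rm b}^n(G,V)$ is the $n$-th cohomology of the complex $$0\to \ell^\infty(G,V)^G\to \ell^\infty(G^2,V)^G\to\ell^\infty(G^3,V)^G\to\cdots$$ where $\ell^\infty(G^{n+1},V)^G$, in degree $n$, is the space of bounded maps $f:G^{n+1}\to V$ with $f(gx_0,\dots,gx_n)=g f(x_0,\dots,x_n)$ for all $g, x_0,\dots,x_n\in G$, and the differential is $(df)(x_0,\dots,x_{n+1})=\sum_{i=0}^{n+1}(-1)^i f(x_0,\dots,\widehat{x_i},\dots,x_{n+1})$. The restriction map ${\rm H}_{\rm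 b}^n(G,V)\to{\rm H}_{\rm b}^n(H,V)$ is induced by restricting cochains from $G^{n+1}$ to $H^{n+1}$. The following are equivalent: (i) $H$ is co-amenable in $G$. (ii) For every dual Banach $G$-module $V$ over $\mathbf K$ and every $n\ge 0$, the restriction map ${\rm H}_{\rm b}^n(G,V)\to{\rm H}_{\rm b}^n(H,V)$ is injective. -/

import Mathlib

universe u v w

/-- A subgroup `H` of a (discrete) group `G` is co-amenable in `G` if every continuous affine
`G`-action on a convex compact subset `K` of a (Hausdorff, real) locally convex space `E` which has
an `H`-fixed point has a `G`-fixed point. The spaces `E` range over the universe `v`. -/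
def IsCoamenable {G : Type u} [Group G] (H : Subgroup G) : Prop :=
  ∀ (E : Type v) [AddCommGroup E] [Module ℝ E] [TopologicalSpace E] [IsTopologicalAddGroup E]
    [ContinuousSMul ℝ E] [LocallyConvexSpace ℝ E] [T2Space E]
    (K : Set E) (hK : Convex ℝ K) (_ : IsCompact K)
    [MulAction G K] [ContinuousConstSMul G K],
    (∀ (g : G) (x y : K) (a b : ℝ) (ha : 0 ≤ a) (hb : 0 ≤ b) (hab : a + b = 1),
      ((g • (⟨a • (x : E) + b • (y : E), hK x.2 y.2 ha hb hab⟩ : K) : K) : E)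
        = a • ((g • x : K) : E) + b • ((g • y : K) : E)) →
    (∃ x : K, ∀ h ∈ H, h • x = x) → ∃ x : K, ∀ g : G, g • x = x

namespace BoundedCohomology

/-- The contragredient of an isometric linear action `ρ` of `G` on `F`: the action of `G` on the
normed dual of `F` given by `(g • φ) x = φ (g⁻¹ • x)`. -/
noncomputable def contragredient {𝕜 : Type*} [RCLike 𝕜] {G : Type*} [Group G]
    {F : Type*} [NormedAddCommGroup F] [NormedSpace 𝕜 F] (ρ : G →* (F ≃ₗᵢ[𝕜] F)) :
    G →* (StrongDual 𝕜 F ≃ₗᵢ[𝕜] StrongDual 𝕜 F) where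
  toFun g :=
    { toFun := fun φ => φ.comp ((ρ g⁻¹ : F ≃ₗᵢ[𝕜] F) : F →L[𝕜] F)
      invFun := fun φ => φ.comp ((ρ g : F ≃ₗᵢ[𝕜] F) : F →L[𝕜] F)
      map_add' := fun _ _ => rfl
      map_smul' := fun _ _ => rfl
      left_inv := fun φ => by ext x; simp [LinearIsometryEquiv.inv_def]
      right_inv := fun φ => by ext x; simp [LinearIsometryEquiv.inv_def]
      norm_map' := fun φ => φ.opNorm_comp_linearIsometryEquiv (ρ g⁻¹) }
  map_one' := by ext φ x; simp
  map_mul' g h := by ext φ x; simp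

theorem contragredient_apply {𝕜 : Type*} [RCLike 𝕜] {G : Type*} [Group G]
    {F : Type*} [NormedAddCommGroup F] [NormedSpace 𝕜 F] (ρ : G →* (F ≃ₗᵢ[𝕜] F))
    (g : G) (φ : StrongDual 𝕜 F) (x : F) : contragredient ρ g φ x = φ (ρ g⁻¹ x) :=
  rfl

section Cohomology

variable {𝕜 : Type*} [RCLike 𝕜] {G : Type*} [Group G]
  {V : Type*} [NormedAddCommGroup V] [NormedSpace 𝕜 V]

/-- `ℓ^∞(G^{n+1}, V)^G`: the bounded maps `f : G^{n+1} → V` which are equivariant, that is,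
`f (g x₀, …, g xₙ) = g • f (x₀, …, xₙ)`, as a subspace of the space of all maps. -/
def cochainSubmodule (ρ : G →* (V ≃ₗᵢ[𝕜] V)) (n : ℕ) :
    Submodule 𝕜 ((Fin (n + 1) → G) → V) where
  carrier := {f | (∃ C : ℝ, ∀ x, ‖f x‖ ≤ C) ∧ ∀ g x, f (fun i => g * x i) = ρ g (f x)}
  zero_mem' := ⟨⟨0, fun x => by simp⟩, fun g x => by simp⟩
  add_mem' := by
    rintro a b ⟨⟨C, hC⟩, ha⟩ ⟨⟨D, hD⟩, hb⟩
    exact ⟨⟨C + D, fun x => norm_add_le_of_le (hC x) (hD x)⟩, fun g x => by simp [ha, hb]⟩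
  smul_mem' := by
    rintro c a ⟨⟨C, hC⟩, ha⟩
    refine ⟨⟨‖c‖ * C, fun x => ?_⟩, fun g x => by simp [ha]⟩
    rw [Pi.smul_apply, norm_smul]
    exact mul_le_mul_of_nonneg_left (hC x) (norm_nonneg c)

/-- The vector space of homogeneous bounded `n`-cochains of `G` with coefficients in `V`. -/
def Cochain (ρ : G →* (V ≃ₗᵢ[𝕜] V)) (n : ℕ) : Type _ := cochainSubmodule ρ n

instance (ρ : G →* (V ≃ₗᵢ[𝕜] V)) (n : ℕ) : AddCommGroup (Cochain ρ n) :=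
  inferInstanceAs (AddCommGroup (cochainSubmodule ρ n))

instance (ρ : G →* (V ≃ₗᵢ[𝕜] V)) (n : ℕ) : Module 𝕜 (Cochain ρ n) :=
  inferInstanceAs (Module 𝕜 (cochainSubmodule ρ n))

theorem Cochain.ext {ρ : G →* (V ≃ₗᵢ[𝕜] V)} {n : ℕ} {f g : Cochain ρ n}
    (h : ∀ x, f.1 x = g.1 x) : f = g :=
  Subtype.ext (funext h)

/-- The homogeneous coboundary
`(d f) (x₀, …, x_{n+1}) = ∑ i, (-1)^i f (x₀, …, x̂ᵢ, …, x_{n+1})`. -/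
def d (ρ : G →* (V ≃ₗᵢ[𝕜] V)) (n : ℕ) : Cochain ρ n →ₗ[𝕜] Cochain ρ (n + 1) where
  toFun f := ⟨fun x => ∑ i : Fin (n + 2), (-1 : 𝕜) ^ (i : ℕ) • f.1 (fun j => x (i.succAbove j)), by
    obtain ⟨⟨C, hC⟩, hf⟩ := f.2
    refine ⟨⟨∑ _i : Fin (n + 2), C, fun x => norm_sum_le_of_le _ fun i _ => ?_⟩, fun g x => ?_⟩
    · simpa [norm_smul] using hC _
    · rw [map_sum]
      refine Finset.sum_congr rfl fun i _ => ?_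
      rw [map_smul, ← hf]⟩
  map_add' f g := Cochain.ext fun x => by
    change ∑ i : Fin (n + 2), (-1 : 𝕜) ^ (i : ℕ) • (f.1 _ + g.1 _) = _
    simp only [smul_add, Finset.sum_add_distrib]
    rfl
  map_smul' c f := Cochain.ext fun x => by
    change ∑ i : Fin (n + 2), (-1 : 𝕜) ^ (i : ℕ) • (c • f.1 _) = _
    simp only [smul_comm _ c, ← Finset.smul_sum]
    rfl

theorem d_apply (ρ : G →* (V ≃ₗᵢ[𝕜] V)) (n : ℕ) (f : Cochain ρ n) (x : Fin (n + 2) → G) :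
    (d ρ n f).1 x = ∑ i : Fin (n + 2), (-1 : 𝕜) ^ (i : ℕ) • f.1 (fun j => x (i.succAbove j)) :=
  rfl

theorem d_d (ρ : G →* (V ≃ₗᵢ[𝕜] V)) (n : ℕ) (f : Cochain ρ n) : d ρ (n + 1) (d ρ n f) = 0 := by
  refine Cochain.ext fun x => ?_
  change _ = (0 : V)
  simp only [d_apply, Finset.smul_sum, smul_smul, ← pow_add]
  rw [← Finset.sum_product', Finset.univ_product_univ]
  refine Finset.sum_involution
    (fun p _ => (p.1.succAbove p.2, p.2.predAbove p.1)) ?_ ?_ ?_ ?_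
  · rintro ⟨i, j⟩ -
    simp only [Fin.succAbove_succAbove_succAbove_predAbove, Fin.neg_one_pow_succAbove_add_predAbove,
      neg_smul, add_neg_cancel]
  · rintro ⟨i, j⟩ - - h
    exact Fin.succAbove_ne i j (congrArg Prod.fst h)
  · simp
  · rintro ⟨i, j⟩ -
    have h := Fin.succAbove_succAbove_predAbove i j
    refine Prod.ext h ?_
    refine Fin.succAbove_right_injective (p := i) ?_
    have h2 := Fin.succAbove_succAbove_predAbove (i.succAbove j) (j.predAbove i)
    rwa [h] at h2

/-- The bounded `n`-cocycles. -/
def cocycles (ρ : G →* (V ≃ₗᵢ[𝕜] V)) (n : ℕ) : Submodule 𝕜 (Cochain ρ n) :=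
  LinearMap.ker (d ρ n)

/-- The bounded `n`-coboundaries; there are no nonzero coboundaries in degree `0`. -/
def coboundaries (ρ : G →* (V ≃ₗᵢ[𝕜] V)) : (n : ℕ) → Submodule 𝕜 (Cochain ρ n)
  | 0 => ⊥
  | n + 1 => LinearMap.range (d ρ n)

theorem coboundaries_le_cocycles (ρ : G →* (V ≃ₗᵢ[𝕜] V)) (n : ℕ) :
    coboundaries ρ n ≤ cocycles ρ n := by
  cases n with
  | zero => exact bot_le
  | succ n =>
    rintro _ ⟨f, rfl⟩
    exact d_d ρ n f

/-- The bounded cohomology `H_b^n(G, V)` of the group `G` with coefficients in the normed space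
`V` with the isometric linear `G`-action `ρ`: bounded cocycles modulo bounded coboundaries. -/
abbrev Hb (ρ : G →* (V ≃ₗᵢ[𝕜] V)) (n : ℕ) : Type _ :=
  cocycles ρ n ⧸ (coboundaries ρ n).submoduleOf (cocycles ρ n)

/-- Restriction of bounded cochains from `G` to the subgroup `H`, where `V` carries the
restricted action `ρ.comp H.subtype` of `H`. -/
def resCochain (ρ : G →* (V ≃ₗᵢ[𝕜] V)) (H : Subgroup G) (n : ℕ) :
    Cochain ρ n →ₗ[𝕜] Cochain (ρ.comp H.subtype) n where
  toFun f := ⟨fun x => f.1 (fun i => (x i : G)),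
    f.2.1.imp fun _ hC _ => hC _, fun h x => f.2.2 h fun i => (x i : G)⟩
  map_add' _ _ := rfl
  map_smul' _ _ := rfl

theorem d_resCochain (ρ : G →* (V ≃ₗᵢ[𝕜] V)) (H : Subgroup G) (n : ℕ) (f : Cochain ρ n) :
    d (ρ.comp H.subtype) n (resCochain ρ H n f) = resCochain ρ H (n + 1) (d ρ n f) :=
  rfl

/-- Restriction of bounded cocycles from `G` to `H`. -/
def resCocycles (ρ : G →* (V ≃ₗᵢ[𝕜] V)) (H : Subgroup G) (n : ℕ) :
    cocycles ρ n →ₗ[𝕜] cocycles (ρ.comp H.subtype) n :=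
  (resCochain ρ H n).restrict fun f (hf : d ρ n f = 0) => by
    change d (ρ.comp H.subtype) n (resCochain ρ H n f) = 0
    rw [d_resCochain, hf, map_zero]

/-- The restriction map `H_b^n(G, V) → H_b^n(H, V)` in bounded cohomology. -/
def res (ρ : G →* (V ≃ₗᵢ[𝕜] V)) (H : Subgroup G) (n : ℕ) :
    Hb ρ n →ₗ[𝕜] Hb (ρ.comp H.subtype) n :=
  Submodule.mapQ _ _ (resCocycles ρ H n) <| by
    rintro ⟨f, hf⟩ hfb
    change resCochain ρ H n f ∈ coboundaries (ρ.comp H.subtype) n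
    change f ∈ coboundaries ρ n at hfb
    cases n with
    | zero =>
      have h0 : f = 0 := hfb
      rw [h0, map_zero]
      exact zero_mem _
    | succ n =>
      obtain ⟨b, rfl⟩ := hfb
      exact ⟨resCochain ρ H n b, d_resCochain ρ H n b⟩

end Cohomology

end BoundedCohomology

/-!
Both conditions are equivalent to the existence of a `G`-invariant mean on the bounded functions
on `G ⧸ H`.

If `H` is co-amenable, such a mean is a `G`-fixed point in the compact convex set of means, where
evaluation at the coset `H` is `H`-fixed (`IsCoamenable.nonempty_invariantMean`). Conversely, a
mean pushed forward along the orbit map `gH ↦ g • x₀` of an `H`-fixed point `x₀` of a compact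
convex set `K` has a barycenter, characterized by its values under *all* continuous affine
functions on `K`; hence it is `G`-fixed (`exists_barycenter`, `isCoamenable_of_invariantMean`).

Given an invariant mean, let `f` be a cocycle on `G` whose restriction to `H` has a primitive.
Composing with an `H`-equivariant retraction `G → H` and correcting by a prism operator gives an
`H`-equivariant bounded primitive of `f` on `G`
(`BoundedCohomology.exists_equivariant_primitive`). Averaging its translates over `G ⧸ H`, which
makes sense because the coefficients are a dual module, turns it into a `G`-equivariant one
(`BoundedCohomology.augD_transfer`).

Conversely, degree one with a single coefficient module is enough: the dual of the bounded
functions on `G ⧸ H` modulo the constants. The cocycle `(g₀, g₁) ↦ δ_{g₁H} - δ_{g₀H}` vanishes on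
`H`. If `b` is a primitive of it on `G`, then `δ_{gH} - b g` does not depend on `g`, so it is an
invariant functional with value `1` at the constant function `1`
(`BoundedCohomology.nonempty_invariantMean_of_primitive`). It need not be positive, but its
positive part, given by the Riesz–Kantorovich formula, is again invariant and, after scaling, is a
mean (`InvariantMean.nonempty_of_functional`).
-/

open BoundedContinuousFunction

/-! ### Invariant means -/

section Mean

variable {G X : Type*} [Group G] [MulAction G X] [TopologicalSpace X] [DiscreteTopology X]

/-- The bounded function `x ↦ f (g • x)`. -/
def bddTranslate {β : Type*} [PseudoMetricSpace β] (g : G) (f : X →ᵇ β) : X →ᵇ β :=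
  f.compContinuous ⟨(g • ·), continuous_of_discreteTopology⟩

@[simp]
theorem bddTranslate_apply {β : Type*} [PseudoMetricSpace β] (g : G) (f : X →ᵇ β) (x : X) :
    bddTranslate g f x = f (g • x) := rfl

variable (G X) in
/-- A `G`-invariant mean on the discrete `G`-set `X`: a positive normalized `G`-invariant linear
functional on the bounded real functions on `X`. -/
structure InvariantMean where
  /-- The underlying linear functional. -/
  toFun : (X →ᵇ ℝ) →ₗ[ℝ] ℝ
  nonneg : ∀ f, 0 ≤ f → 0 ≤ toFun f
  map_one : toFun 1 = 1
  map_translate : ∀ (g : G) f, toFun (bddTranslate g f) = toFun f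

end Mean

/-! ### The positive part of a functional on bounded functions -/

section PositivePart

variable {X : Type*} [TopologicalSpace X]

/-- The value at `f ≥ 0` of the positive part of the functional `μ`, given by the
Riesz–Kantorovich formula. -/
noncomputable def posPartAux (μ : (X →ᵇ ℝ) →L[ℝ] ℝ) (f : X →ᵇ ℝ) : ℝ :=
  sSup (μ '' Set.Icc 0 f)

theorem bddAbove_image_Icc (μ : (X →ᵇ ℝ) →L[ℝ] ℝ) (f : X →ᵇ ℝ) :
    BddAbove (μ '' Set.Icc 0 f) := by
  refine ⟨‖μ‖ * ‖f‖, ?_⟩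
  rintro _ ⟨g, ⟨hg0, hgf⟩, rfl⟩
  have hg : ‖g‖ ≤ ‖f‖ := HasSolidNorm.solid (by
    rwa [abs_of_nonneg hg0, abs_of_nonneg (hg0.trans hgf)])
  exact (le_abs_self _).trans ((μ.le_opNorm g).trans (by gcongr))

theorem le_posPartAux (μ : (X →ᵇ ℝ) →L[ℝ] ℝ) {f g : X →ᵇ ℝ} (h0 : 0 ≤ g) (h : g ≤ f) :
    μ g ≤ posPartAux μ f :=
  le_csSup (bddAbove_image_Icc μ f) ⟨g, ⟨h0, h⟩, rfl⟩

theorem posPartAux_le (μ : (X →ᵇ ℝ) →L[ℝ] ℝ) {f : X →ᵇ ℝ} (hf : 0 ≤ f) {c : ℝ}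
    (h : ∀ g, 0 ≤ g → g ≤ f → μ g ≤ c) : posPartAux μ f ≤ c := by
  refine csSup_le ⟨_, 0, ⟨le_rfl, hf⟩, rfl⟩ ?_
  rintro _ ⟨g, ⟨hg0, hgf⟩, rfl⟩
  exact h g hg0 hgf

theorem posPartAux_nonneg (μ : (X →ᵇ ℝ) →L[ℝ] ℝ) {f : X →ᵇ ℝ} (hf : 0 ≤ f) :
    0 ≤ posPartAux μ f := by
  simpa using le_posPartAux μ le_rfl hf

theorem posPartAux_add (μ : (X →ᵇ ℝ) →L[ℝ] ℝ) {f g : X →ᵇ ℝ} (hf : 0 ≤ f) (hg : 0 ≤ g) :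
    posPartAux μ (f + g) = posPartAux μ f + posPartAux μ g := by
  apply le_antisymm
  · refine posPartAux_le μ (add_nonneg hf hg) fun k hk0 hk => ?_
    -- Riesz decomposition: `k = k ⊓ f + (k - k ⊓ f)` with `k - k ⊓ f ≤ g`.
    have h1 : k - k ⊓ f ≤ g := by
      rw [sub_le_iff_le_add, ← sub_le_iff_le_add']
      exact le_inf (sub_le_self _ hg) (sub_le_iff_le_add.2 hk)
    have h2 := le_posPartAux μ (le_inf hk0 hf) (inf_le_right : k ⊓ f ≤ f)
    have h3 := le_posPartAux μ (sub_nonneg.2 (inf_le_left : k ⊓ f ≤ k)) h1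
    rw [map_sub] at h3
    linarith
  · rw [← le_sub_iff_add_le]
    refine posPartAux_le μ hf fun k hk0 hk => ?_
    rw [le_sub_comm]
    refine posPartAux_le μ hg fun l hl0 hl => ?_
    have := le_posPartAux μ (add_nonneg hk0 hl0) (add_le_add hk hl)
    rw [map_add] at this
    linarith

theorem posPartAux_le_norm (μ : (X →ᵇ ℝ) →L[ℝ] ℝ) {f g : X →ᵇ ℝ} (hf : 0 ≤ f)
    (hfg : f ≤ |g|) : posPartAux μ f ≤ ‖μ‖ * ‖g‖ := by
  refine posPartAux_le μ hf fun k hk0 hk => ?_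
  have hg : ‖k‖ ≤ ‖g‖ := HasSolidNorm.solid (by rw [abs_of_nonneg hk0]; exact hk.trans hfg)
  exact (le_abs_self _).trans ((μ.le_opNorm k).trans (by gcongr))

/-- The positive part of a bounded functional on the bounded continuous functions. -/
noncomputable def posPartFunctional (μ : (X →ᵇ ℝ) →L[ℝ] ℝ) : (X →ᵇ ℝ) →L[ℝ] ℝ :=
  AddMonoidHom.toRealLinearMap
    (AddMonoidHom.mk' (fun f => posPartAux μ f⁺ - posPartAux μ f⁻) fun f g => by
      have h : (f + g)⁺ + (f⁻ + g⁻) = (f + g)⁻ + (f⁺ + g⁺) := by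
        linear_combination posPart_sub_negPart (f + g) - posPart_sub_negPart f -
          posPart_sub_negPart g
      have h' := congrArg (posPartAux μ) h
      have p := fun k : X →ᵇ ℝ => posPart_nonneg k
      have n := fun k : X →ᵇ ℝ => negPart_nonneg k
      rw [posPartAux_add μ (p _) (add_nonneg (n _) (n _)),
        posPartAux_add μ (n _) (add_nonneg (p _) (p _)),
        posPartAux_add μ (n _) (n _), posPartAux_add μ (p _) (p _)] at h'
      linarith) <|
  AddMonoidHomClass.continuous_of_bound _ ‖μ‖ fun f => by
    change |posPartAux μ f⁺ - posPartAux μ f⁻| ≤ _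
    have h1 := posPartAux_le_norm μ (posPart_nonneg f) (sup_le (le_abs_self f) (abs_nonneg f))
    have h2 := posPartAux_le_norm μ (negPart_nonneg f) (sup_le (neg_le_abs f) (abs_nonneg f))
    have h3 := posPartAux_nonneg μ (posPart_nonneg f)
    have h4 := posPartAux_nonneg μ (negPart_nonneg f)
    rw [abs_le]
    constructor <;> linarith

theorem posPartFunctional_apply (μ : (X →ᵇ ℝ) →L[ℝ] ℝ) (f : X →ᵇ ℝ) :
    posPartFunctional μ f = posPartAux μ f⁺ - posPartAux μ f⁻ := rfl

theorem posPartFunctional_of_nonneg (μ : (X →ᵇ ℝ) →L[ℝ] ℝ) {f : X →ᵇ ℝ} (hf : 0 ≤ f) :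
    posPartFunctional μ f = posPartAux μ f := by
  have : posPartAux μ 0 = 0 := by
    simpa using posPartAux_add μ (le_refl (0 : X →ᵇ ℝ)) le_rfl
  rw [posPartFunctional_apply, posPart_eq_self.2 hf, negPart_eq_zero.2 hf, this, sub_zero]

variable {G : Type*} [Group G] [MulAction G X] [DiscreteTopology X]

theorem posPartAux_translate {μ : (X →ᵇ ℝ) →L[ℝ] ℝ} (hμ : ∀ (g : G) f, μ (bddTranslate g f) = μ f)
    (g : G) {f : X →ᵇ ℝ} (hf : 0 ≤ f) :
    posPartAux μ (bddTranslate g f) = posPartAux μ f := by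
  have h0 : 0 ≤ bddTranslate g f := fun x => hf (g • x)
  have key : ∀ (g : G) {f : X →ᵇ ℝ}, 0 ≤ f → posPartAux μ f ≤ posPartAux μ (bddTranslate g f) := by
    intro g f hf
    refine posPartAux_le μ hf fun k hk0 hk => ?_
    rw [← hμ g k]
    exact le_posPartAux μ (fun x => hk0 (g • x)) (fun x => hk (g • x))
  refine le_antisymm ((key g⁻¹ h0).trans_eq ?_) (key g hf)
  congr 1
  ext x
  simp

/-- A bounded invariant functional which does not kill constants yields an invariant mean: its
positive part is again invariant, by uniqueness of the Jordan decomposition. -/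
theorem InvariantMean.nonempty_of_functional (μ : (X →ᵇ ℝ) →L[ℝ] ℝ) (h1 : μ 1 = 1)
    (hμ : ∀ (g : G) f, μ (bddTranslate g f) = μ f) : Nonempty (InvariantMean G X) := by
  have h01 : (0 : X →ᵇ ℝ) ≤ 1 := fun x => zero_le_one (α := ℝ)
  set c := posPartAux μ 1 with hc
  have hc1 : 1 ≤ c := h1.symm.le.trans (le_posPartAux μ h01 le_rfl)
  refine ⟨⟨c⁻¹ • (posPartFunctional μ : (X →ᵇ ℝ) →ₗ[ℝ] ℝ), fun f hf => ?_, ?_, fun g f => ?_⟩⟩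
  · change 0 ≤ c⁻¹ * posPartFunctional μ f
    rw [posPartFunctional_of_nonneg μ hf]
    have := posPartAux_nonneg μ hf
    positivity
  · change c⁻¹ * posPartFunctional μ 1 = 1
    rw [posPartFunctional_of_nonneg μ h01, ← hc, inv_mul_cancel₀ (by positivity)]
  · change c⁻¹ * posPartFunctional μ _ = c⁻¹ * posPartFunctional μ _
    have hp : (bddTranslate g f)⁺ = bddTranslate g f⁺ := by ext x; rfl
    have hn : (bddTranslate g f)⁻ = bddTranslate g f⁻ := by ext x; rfl
    rw [posPartFunctional_apply, posPartFunctional_apply, hp, hn,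
      posPartAux_translate hμ g (posPart_nonneg f), posPartAux_translate hμ g (negPart_nonneg f)]

end PositivePart

/-! ### Barycenters and co-amenability -/

section Barycenter

variable {X : Type*} [TopologicalSpace X] [DiscreteTopology X]
  {E : Type*} [TopologicalSpace E] {K : Set E}

/-- The bounded function `x ↦ a (o x)`, for `a` continuous on the compact set `K`. -/
noncomputable def bddComp (hKc : IsCompact K) (o : X → K) (a : K → ℝ) (ha : Continuous a) :
    X →ᵇ ℝ :=
  haveI := isCompact_iff_compactSpace.1 hKc
  (BoundedContinuousFunction.mkOfCompact ⟨a, ha⟩).compContinuous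
    ⟨o, continuous_of_discreteTopology⟩

theorem bddComp_apply (hKc : IsCompact K) (o : X → K) (a : K → ℝ) (ha : Continuous a) (x : X) :
    bddComp hKc o a ha x = a (o x) := rfl

variable [AddCommGroup E] [Module ℝ E]

/-- The function `a` on the convex set `K` is continuous and affine. -/
def IsContAffine (hK : Convex ℝ K) (a : K → ℝ) : Prop :=
  Continuous a ∧ ∀ (x y : K) (s t : ℝ) (hs : 0 ≤ s) (ht : 0 ≤ t) (hst : s + t = 1),
    a ⟨s • (x : E) + t • (y : E), hK x.2 y.2 hs ht hst⟩ = s * a x + t * a y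

/-- Every mean on `X` pushed forward to a compact convex set `K` has a barycenter in `K`. By
compactness only finitely many affine functions need be considered at a time, and then the claim
is the Hahn–Banach theorem in a finite-dimensional space. -/
theorem exists_barycenter (m : (X →ᵇ ℝ) →ₗ[ℝ] ℝ) (hm : ∀ f, 0 ≤ f → 0 ≤ m f) (hm1 : m 1 = 1)
    (hK : Convex ℝ K) (hKc : IsCompact K) (o : X → K) :
    ∃ z : K, ∀ (a : K → ℝ) (ha : IsContAffine hK a), a z = m (bddComp hKc o a ha.1) := by
  have := isCompact_iff_compactSpace.1 hKc
  let A := {a : K → ℝ // IsContAffine hK a}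
  obtain ⟨z, hz⟩ := CompactSpace.iInter_nonempty
    (t := fun a : A => {z : K | a.1 z = m (bddComp hKc o a.1 a.2.1)})
    (fun a => isClosed_eq a.2.1 continuous_const) (fun s => by
      let Φ : K → s → ℝ := fun z a => a.1.1 z
      let p : s → ℝ := fun a => m (bddComp hKc o a.1.1 a.1.2.1)
      have hΦ : Continuous Φ := continuous_pi fun a => a.1.2.1
      suffices h : p ∈ Set.range Φ by
        obtain ⟨z, hz⟩ := h
        exact ⟨z, Set.mem_iInter₂.2 fun a ha => congrFun hz ⟨a, ha⟩⟩
      by_contra hp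
      have hconv : Convex ℝ (Set.range Φ) := by
        rintro _ ⟨x, rfl⟩ _ ⟨y, rfl⟩ b c hb hc hbc
        exact ⟨⟨_, hK x.2 y.2 hb hc hbc⟩, funext fun a => a.1.2.2 x y b c hb hc hbc⟩
      obtain ⟨l, u, hlu, hl⟩ := geometric_hahn_banach_point_closed hconv
        (isCompact_range hΦ).isClosed hp
      classical
      have hsum : ∀ q : s → ℝ, l q = ∑ a, q a * l (fun j => if a = j then 1 else 0) := fun q => by
        simpa using LinearMap.pi_apply_eq_sum_univ (l : (s → ℝ) →ₗ[ℝ] ℝ) q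
      let F : X →ᵇ ℝ := ∑ a : s, l (fun j => if a = j then 1 else 0) • bddComp hKc o a.1.1 a.1.2.1
      have hF : ∀ x, F x = l (Φ (o x)) := fun x => by
        rw [hsum]
        simp [F, BoundedContinuousFunction.coe_sum, bddComp_apply, Φ, mul_comm]
      have hmF : m F = l p := by
        rw [hsum, map_sum]
        simp [p, mul_comm]
      have h0 : 0 ≤ F - u • (1 : X →ᵇ ℝ) := fun x => by
        have := hl _ ⟨o x, rfl⟩
        change 0 ≤ F x - u * 1
        rw [hF]
        linarith
      have := hm _ h0
      rw [map_sub, map_smul, hm1, hmF, smul_eq_mul] at this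
      linarith)
  exact ⟨z, fun a ha => Set.mem_iInter.1 hz ⟨a, ha⟩⟩

end Barycenter

/-- The barycenter of the image of an invariant mean under the orbit map of an `H`-fixed point is
a `G`-fixed point. -/
theorem isCoamenable_of_invariantMean {G : Type u} [Group G] (H : Subgroup G)
    [TopologicalSpace (G ⧸ H)] [DiscreteTopology (G ⧸ H)] (m : InvariantMean G (G ⧸ H)) :
    IsCoamenable.{u, v} H := by
  intro E _ _ _ _ _ _ _ K hK hKc _ _ haff ⟨x₀, hx₀⟩
  let o : G ⧸ H → K := Quotient.lift (fun g : G => g • x₀) fun g g' hgg' => by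
    have h := hx₀ _ (QuotientGroup.leftRel_apply.1 hgg')
    calc g • x₀ = g • (g⁻¹ * g') • x₀ := by rw [h]
      _ = g' • x₀ := by rw [smul_smul, mul_inv_cancel_left]
  have ho : ∀ (g : G) (q : G ⧸ H), o (g • q) = g • o q := by
    intro g q
    induction q using QuotientGroup.induction_on with
    | H k => exact mul_smul g k x₀
  obtain ⟨z, hz⟩ := exists_barycenter m.toFun m.nonneg m.map_one hK hKc o
  refine ⟨z, fun g => ?_⟩
  by_contra hne
  obtain ⟨l, hl⟩ := geometric_hahn_banach_point_point (fun h => hne (Subtype.ext h))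
  have ha : IsContAffine hK fun x : K => l x :=
    ⟨l.continuous.comp continuous_subtype_val, fun x y s t _ _ _ => by simp⟩
  have ha' : IsContAffine hK fun x : K => l (g • x : K) :=
    ⟨ha.1.comp (continuous_const_smul g), fun x y s t hs ht hst => by
      change l (g • _ : K) = s * l (g • x : K) + t * l (g • y : K)
      rw [haff g x y s t hs ht hst, map_add, map_smul, map_smul, smul_eq_mul, smul_eq_mul]⟩
  refine hl.ne ?_
  rw [hz _ ha, hz _ ha', ← m.map_translate g (bddComp hKc o _ ha.1)]
  congr 1
  ext q
  rw [bddTranslate_apply, bddComp_apply, bddComp_apply, ho]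

/-- Means on `G ⧸ H` form a compact convex set, and evaluation at the base point is an `H`-fixed
mean. -/
theorem IsCoamenable.nonempty_invariantMean {G : Type u} [Group G] {H : Subgroup G}
    [TopologicalSpace (G ⧸ H)] [DiscreteTopology (G ⧸ H)] (h : IsCoamenable.{u, max u v} H) :
    Nonempty (InvariantMean G (G ⧸ H)) := by
  let B := (G ⧸ H) →ᵇ ℝ
  -- Indexing by the lift of `B` puts the ambient space in the required universe.
  let E : Type (max u v) := ULift.{v} B → ℝ
  let K : Set E := {φ | (∀ f k : B, φ ⟨f + k⟩ = φ ⟨f⟩ + φ ⟨k⟩) ∧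
    (∀ (c : ℝ) (f : B), φ ⟨c • f⟩ = c * φ ⟨f⟩) ∧ (∀ f : B, 0 ≤ f → 0 ≤ φ ⟨f⟩) ∧ φ ⟨1⟩ = 1}
  have hK : Convex ℝ K := by
    rintro φ ⟨h1, h2, h3, h4⟩ ψ ⟨k1, k2, k3, k4⟩ a b ha hb hab
    have e : ∀ f : B, (a • φ + b • ψ) ⟨f⟩ = a * φ ⟨f⟩ + b * ψ ⟨f⟩ := fun _ => rfl
    refine ⟨fun f k => ?_, fun c f => ?_, fun f hf => ?_, ?_⟩ <;> simp only [e]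
    · rw [h1, k1]; ring
    · rw [h2, k2]; ring
    · exact add_nonneg (mul_nonneg ha (h3 f hf)) (mul_nonneg hb (k3 f hf))
    · rw [h4, k4]; linarith
  have hKcl : IsClosed K := by
    have e : ∀ f : B, Continuous fun φ : E => φ ⟨f⟩ := fun f => continuous_apply _
    have : K = (⋂ (f : B) (k : B), {φ : E | φ ⟨f + k⟩ = φ ⟨f⟩ + φ ⟨k⟩}) ∩
        (⋂ (c : ℝ) (f : B), {φ : E | φ ⟨c • f⟩ = c * φ ⟨f⟩}) ∩
        (⋂ (f : B) (_ : 0 ≤ f), {φ : E | 0 ≤ φ ⟨f⟩}) ∩ {φ : E | φ ⟨1⟩ = 1} := by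
      ext φ
      simp [K, and_assoc]
    rw [this]
    refine ((IsClosed.inter ?_ ?_).inter ?_).inter ?_
    · exact isClosed_iInter fun f => isClosed_iInter fun k => isClosed_eq (e _) ((e _).add (e _))
    · exact isClosed_iInter fun c => isClosed_iInter fun k =>
        isClosed_eq (e _) (continuous_const.mul (e _))
    · exact isClosed_iInter fun c => isClosed_iInter fun k => isClosed_le continuous_const (e _)
    · exact isClosed_eq (e _) continuous_const
  have hKc : IsCompact K := by
    refine (isCompact_univ_pi fun i : ULift.{v} B =>
      isCompact_Icc (a := -‖i.down‖) (b := ‖i.down‖)).of_isClosed_subset hKcl ?_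
    rintro φ ⟨h1, h2, h3, h4⟩ ⟨f⟩ -
    have a1 := h3 (‖f‖ • (1 : B) + f) fun x => by
      have := abs_le.1 (f.norm_coe_le_norm x)
      change 0 ≤ ‖f‖ * 1 + f x
      linarith
    have a2 := h3 (‖f‖ • (1 : B) + (-1 : ℝ) • f) fun x => by
      have := abs_le.1 (f.norm_coe_le_norm x)
      change 0 ≤ ‖f‖ * 1 + -1 * f x
      linarith
    rw [h1, h2, h4] at a1
    rw [h1, h2, h4, h2] at a2
    constructor <;> simp only <;> linarith
  let act : MulAction G K :=
    { smul := fun g φ => ⟨fun f => φ.1 ⟨bddTranslate g f.down⟩,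
        fun f k => φ.2.1 (bddTranslate g f) (bddTranslate g k),
        fun c f => φ.2.2.1 c (bddTranslate g f),
        fun f hf => φ.2.2.2.1 (bddTranslate g f) fun x => hf (g • x), φ.2.2.2.2⟩
      one_smul := fun φ => Subtype.ext <| funext fun f => congrArg φ.1 <|
        congrArg ULift.up (by ext x; simp)
      mul_smul := fun g k φ => Subtype.ext <| funext fun f => congrArg φ.1 <|
        congrArg ULift.up (by ext x; simp [mul_smul]) }
  have hact : ∀ (g : G) (φ : K) (f : B), (g • φ : K).1 ⟨f⟩ = φ.1 ⟨bddTranslate g f⟩ :=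
    fun _ _ _ => rfl
  have : ContinuousConstSMul G K := ⟨fun g => continuous_induced_rng.2 <| continuous_pi fun f =>
    (continuous_apply (ULift.up (bddTranslate g f.down))).comp continuous_subtype_val⟩
  obtain ⟨φ, hφ⟩ := h E K hK hKc (fun g x y a b ha hb hab => rfl)
    ⟨⟨fun f => f.down ((1 : G) : G ⧸ H), fun _ _ => rfl, fun _ _ => rfl, fun f hf => hf _, rfl⟩,
      fun g hg => Subtype.ext <| funext fun f => congrArg f.down <| by
        change ((g * 1 : G) : G ⧸ H) = ((1 : G) : G ⧸ H)
        rw [QuotientGroup.eq]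
        simpa using hg⟩
  exact ⟨⟨{ toFun := fun f => φ.1 ⟨f⟩, map_add' := φ.2.1, map_smul' := φ.2.2.1 },
    φ.2.2.2.1, φ.2.2.2.2, fun g f => by
      change φ.1 ⟨bddTranslate g f⟩ = φ.1 ⟨f⟩
      rw [← hact, hφ g]⟩⟩

/-! ### The prism operator -/

section Prism

variable {𝕜 G V : Type*} [RCLike 𝕜] [NormedAddCommGroup V] [NormedSpace 𝕜 V]

/-- The augmented homogeneous coboundary on all maps `G^n → V`, `n ≥ 0`, with no equivariance or
boundedness required. -/
def augD (𝕜 : Type*) [RCLike 𝕜] [NormedSpace 𝕜 V] {n : ℕ} (f : (Fin n → G) → V)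
    (x : Fin (n + 1) → G) : V :=
  ∑ i : Fin (n + 1), (-1 : 𝕜) ^ (i : ℕ) • f (fun j => x (i.succAbove j))

/-- The cone operator: fix the first variable. -/
def cone {n : ℕ} (a : G) (f : (Fin (n + 1) → G) → V) (x : Fin n → G) : V :=
  f (Fin.cons a x)

/-- The prism operator, a chain homotopy between the identity and composition with `r`. Unfolding
the recursion gives the usual sum of `± f (r x₀, …, r xᵢ, xᵢ, …, xₙ)`. -/
def prism (r : G → G) : {n : ℕ} → ((Fin (n + 1) → G) → V) → (Fin n → G) → V
  | 0, _, _ => 0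
  | _ + 1, f, x => f (Fin.cons (r (x 0)) x) - prism r (cone (r (x 0)) f) (Fin.tail x)

/-- Fixing the first variable is a contraction of the augmented complex:
`cone a (augD f) + augD (cone a f) = f`. -/
theorem augD_cons {n : ℕ} (f : (Fin (n + 1) → G) → V) (a : G) (x : Fin (n + 1) → G) :
    augD 𝕜 f (Fin.cons a x) = f x - augD 𝕜 (cone a f) x := by
  unfold augD cone
  rw [Fin.sum_univ_succ]
  simp only [Fin.val_zero, pow_zero, one_smul, Fin.zero_succAbove, Fin.cons_succ, Fin.val_succ,
    pow_succ, mul_neg, mul_one, neg_smul, Finset.sum_neg_distrib, ← sub_eq_add_neg]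
  congr 1
  refine Finset.sum_congr rfl fun i _ => ?_
  congr 2
  funext j
  cases j using Fin.cases with
  | zero => simp
  | succ j => simp

theorem augD_sub {n : ℕ} (f g : (Fin n → G) → V) :
    augD 𝕜 (fun x => f x - g x) = fun x => augD 𝕜 f x - augD 𝕜 g x := by
  funext x
  simp [augD, smul_sub, Finset.sum_sub_distrib]

theorem prism_sub (r : G → G) {n : ℕ} (f g : (Fin (n + 1) → G) → V) :
    prism r (fun x => f x - g x) = fun x => prism r f x - prism r g x := by
  induction n with
  | zero => funext x; simp [prism]
  | succ n ih =>
    funext x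
    have := congrFun (ih (cone (r (x 0)) f) (cone (r (x 0)) g)) (Fin.tail x)
    change f _ - g _ - prism r (fun y => cone (r (x 0)) f y - cone (r (x 0)) g y) _ = _
    rw [this]
    simp only [prism]
    abel

/-- The homotopy identity; it follows by induction from the contraction identity `augD_cons`. -/
theorem augD_prism (r : G → G) {n : ℕ} (f : (Fin (n + 1) → G) → V) (x : Fin (n + 1) → G) :
    augD 𝕜 (prism r f) x + prism r (augD 𝕜 f) x = f x - f (fun i => r (x i)) := by
  have hc : ∀ {m : ℕ} (f : (Fin (m + 2) → G) → V) (a : G), cone a (augD 𝕜 f) =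
      fun y => f y - augD 𝕜 (cone a f) y := fun f a => funext fun y => augD_cons f a y
  induction n with
  | zero =>
    have h0 : prism r (augD 𝕜 f) x = augD 𝕜 f (Fin.cons (r (x 0)) x) := by
      simp [prism]
    rw [h0, augD_cons]
    simp [augD, prism, cone]
    congr 2
    funext i
    cases i using Fin.cases with
    | zero => rfl
    | succ i => exact i.elim0
  | succ n ih =>
    obtain ⟨a, y, rfl⟩ : ∃ a y, x = Fin.cons a y := ⟨x 0, Fin.tail x, (Fin.cons_self_tail x).symm⟩
    have hr : (fun i => r ((Fin.cons a y : Fin (n + 2) → G) i)) =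
        Fin.cons (r a) (fun i => r (y i)) := by
      funext i
      cases i using Fin.cases <;> simp
    have h1 : cone a (prism r f) =
        fun z => cone a (cone (r a) f) z - prism r (cone (r a) f) z := by
      funext z
      simp [cone, prism]
    have h2 : prism r (augD 𝕜 f) (Fin.cons a y) =
        augD 𝕜 f (Fin.cons (r a) (Fin.cons a y)) - prism r (cone (r a) (augD 𝕜 f)) y := by
      simp [prism]
    have h3 := ih (cone (r a) f) y
    rw [hr, augD_cons, h1, augD_sub, h2, hc, prism_sub, augD_cons, augD_cons]
    change _ = f (Fin.cons a y) - cone (r a) f (fun i => r (y i))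
    rw [← sub_eq_zero] at h3 ⊢
    rw [← h3]
    beta_reduce
    abel

theorem norm_prism_le (r : G → G) {n : ℕ} (f : (Fin (n + 1) → G) → V) {C : ℝ}
    (hf : ∀ x, ‖f x‖ ≤ C) (x : Fin n → G) : ‖prism r f x‖ ≤ n * C := by
  induction n with
  | zero => simp [prism]
  | succ n ih =>
    have := norm_sub_le_of_le (hf (Fin.cons (r (x 0)) x))
      (ih (cone (r (x 0)) f) (fun y => hf _) (Fin.tail x))
    simp only [prism]
    push_cast
    linarith

/-- If `r` commutes with left multiplication by `h`, the prism operator preserves equivariance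
under `h`. The induction takes cones at `h * a` on one side and at `a` on the other, so it needs two
maps `f` and `f'`. -/
theorem prism_smul [Group G] (r : G → G) (h : G) (hr : ∀ x, r (h * x) = h * r x) (T : V ≃ₗᵢ[𝕜] V)
    {n : ℕ} (f : (Fin (n + 1) → G) → V) (f' : (Fin (n + 1) → G) → V)
    (hf : ∀ x, f (fun i => h * x i) = T (f' x)) (x : Fin n → G) :
    prism r f (fun i => h * x i) = T (prism r f' x) := by
  induction n with
  | zero => simp [prism]
  | succ n ih =>
    have hcons : ∀ {m : ℕ} (a : G) (y : Fin m → G), (Fin.cons (h * a) (fun i => h * y i) :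
        Fin (m + 1) → G) = fun i => h * (Fin.cons a y : Fin (m + 1) → G) i := by
      intro m a y
      funext i
      cases i using Fin.cases <;> simp
    have := ih (cone (h * r (x 0)) f) (cone (r (x 0)) f')
      (fun y => by unfold cone; rw [hcons, hf]) (Fin.tail x)
    simp only [prism, hr, map_sub]
    rw [hcons, hf, ← this]
    rfl

end Prism

/-- A subgroup `H` of `G` is an `H`-equivariant retract of `G`. -/
theorem exists_equivariant_retraction {G : Type*} [Group G] (H : Subgroup G) :
    ∃ r : G → H, ∀ (h : H) (x : G), r (h * x) = h * r x := by
  -- The representatives of the right cosets are the inverses of those of the left cosets.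
  let s : G → G := fun x => ((x⁻¹ : G) : G ⧸ H).out
  have hs : ∀ x, x * s x ∈ H := fun x => by
    have := QuotientGroup.eq.1 (QuotientGroup.out_eq' ((x⁻¹ : G) : G ⧸ H)).symm
    simpa using this
  refine ⟨fun x => ⟨x * s x, hs x⟩, fun h x => Subtype.ext ?_⟩
  have : (((h * x)⁻¹ : G) : G ⧸ H) = ((x⁻¹ : G) : G ⧸ H) := by
    rw [QuotientGroup.eq]
    simp
  change h * x * s (h * x) = h * (x * s x)
  simp only [s, this, mul_assoc]

namespace BoundedCohomology

/-- The primitive on `H` is transported to `G` by an `H`-equivariant retraction, which is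
homotopic to the identity. -/
theorem exists_equivariant_primitive {𝕜 G V : Type*} [RCLike 𝕜] [Group G] [NormedAddCommGroup V]
    [NormedSpace 𝕜 V] (ρ : G →* (V ≃ₗᵢ[𝕜] V)) (H : Subgroup G) {n : ℕ} (f : Cochain ρ (n + 1))
    (hf : d ρ (n + 1) f = 0) (b : Cochain (ρ.comp H.subtype) n)
    (hb : d (ρ.comp H.subtype) n b = resCochain ρ H (n + 1) f) :
    ∃ c : (Fin (n + 1) → G) → V, (∃ C : ℝ, ∀ x, ‖c x‖ ≤ C) ∧
      (∀ h ∈ H, ∀ x, c (fun i => h * x i) = ρ h (c x)) ∧ ∀ x, augD 𝕜 c x = f.1 x := by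
  obtain ⟨r, hr⟩ := exists_equivariant_retraction H
  let r' : G → G := fun x => r x
  obtain ⟨⟨C, hC⟩, hfe⟩ := f.2
  obtain ⟨⟨B, hB⟩, hbe⟩ := b.2
  refine ⟨fun x => b.1 (fun i => r (x i)) + prism r' f.1 x, ⟨B + ((n + 1 : ℕ) : ℝ) * C, fun x =>
    norm_add_le_of_le (hB _) (norm_prism_le r' f.1 hC x)⟩, fun h hh x => ?_, fun x => ?_⟩
  · simp only [map_add]
    congr 1
    · have := hbe ⟨h, hh⟩ (fun i => r (x i))
      rw [show (fun i => r (h * x i)) = fun i => ⟨h, hh⟩ * r (x i) from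
        funext fun i => hr ⟨h, hh⟩ (x i)]
      exact this
    · exact prism_smul r' h (fun y => congrArg Subtype.val (hr ⟨h, hh⟩ y)) (ρ h) f.1 f.1 (hfe h) x
  · have h1 := augD_prism (𝕜 := 𝕜) r' f.1 x
    have h2 : augD 𝕜 f.1 = fun _ => 0 := congrArg Subtype.val hf
    have h3 : prism r' (fun _ : Fin (n + 1 + 1 + 1) → G => (0 : V)) x = 0 := by
      simpa using congrFun (prism_sub r' (fun _ : Fin (n + 1 + 1 + 1) → G => (0 : V))
        (fun _ => 0)) x
    have h4 : augD 𝕜 (fun y : Fin (n + 1) → G => b.1 (fun i => r (y i))) x =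
        f.1 (fun i => r' (x i)) := congrFun (congrArg Subtype.val hb) (fun i => r (x i))
    rw [h2, h3, add_zero] at h1
    have h5 : augD 𝕜 (fun x => b.1 (fun i => r (x i)) + prism r' f.1 x) x =
        augD 𝕜 (fun y : Fin (n + 1) → G => b.1 (fun i => r (y i))) x +
          augD 𝕜 (prism r' f.1) x := by
      simp [augD, smul_add, Finset.sum_add_distrib]
    rw [h5, h4, h1, add_sub_cancel]

end BoundedCohomology

/-! ### Extension of means to scalar-valued functions -/

section Extension

variable {G X : Type*} [Group G] [MulAction G X] [TopologicalSpace X] [DiscreteTopology X]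

theorem InvariantMean.norm_le (m : InvariantMean G X) (f : X →ᵇ ℝ) : ‖m.toFun f‖ ≤ ‖f‖ := by
  have h1 := m.nonneg (‖f‖ • (1 : X →ᵇ ℝ) - f) fun x => by
    have := abs_le.1 (f.norm_coe_le_norm x)
    change 0 ≤ ‖f‖ * 1 - f x
    linarith
  have h2 := m.nonneg (‖f‖ • (1 : X →ᵇ ℝ) + f) fun x => by
    have := abs_le.1 (f.norm_coe_le_norm x)
    change 0 ≤ ‖f‖ * 1 + f x
    linarith
  rw [map_sub, map_smul, m.map_one, smul_eq_mul] at h1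
  rw [map_add, map_smul, m.map_one, smul_eq_mul] at h2
  rw [Real.norm_eq_abs, abs_le]
  constructor <;> linarith

/-- The image of an invariant mean under an equivariant map. -/
def InvariantMean.map {Y : Type*} [MulAction G Y] [TopologicalSpace Y] [DiscreteTopology Y]
    (m : InvariantMean G X) (p : X → Y) (hp : ∀ (g : G) x, p (g • x) = g • p x) :
    InvariantMean G Y where
  toFun :=
    { toFun := fun f => m.toFun (f.compContinuous ⟨p, continuous_of_discreteTopology⟩)
      map_add' := fun f k => m.toFun.map_add
        (f.compContinuous ⟨p, continuous_of_discreteTopology⟩)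
        (k.compContinuous ⟨p, continuous_of_discreteTopology⟩)
      map_smul' := fun c f => m.toFun.map_smul c
        (f.compContinuous ⟨p, continuous_of_discreteTopology⟩) }
  nonneg f hf := m.nonneg _ fun x => hf (p x)
  map_one := m.map_one
  map_translate g f := by
    refine Eq.trans (congrArg m.toFun ?_) (m.map_translate g _)
    ext x
    change f (g • p x) = f (p (g • x))
    rw [hp]

variable (𝕜 : Type*) [RCLike 𝕜]

/-- The `𝕜`-linear extension of a mean to `𝕜`-valued bounded functions. -/
noncomputable def InvariantMean.extend (m : InvariantMean G X) : (X →ᵇ 𝕜) →ₗ[𝕜] 𝕜 where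
  toFun f := (m.toFun (RCLike.reCLM.compLeftContinuousBounded X f) : 𝕜) +
    RCLike.I * (m.toFun (RCLike.imCLM.compLeftContinuousBounded X f) : 𝕜)
  map_add' f k := by
    simp only [map_add]
    ring
  map_smul' c f := by
    have h1 : RCLike.reCLM.compLeftContinuousBounded X (c • f) =
        RCLike.re c • RCLike.reCLM.compLeftContinuousBounded X f -
          RCLike.im c • RCLike.imCLM.compLeftContinuousBounded X f := by
      ext x; simp [RCLike.mul_re]
    have h2 : RCLike.imCLM.compLeftContinuousBounded X (c • f) =
        RCLike.re c • RCLike.imCLM.compLeftContinuousBounded X f +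
          RCLike.im c • RCLike.reCLM.compLeftContinuousBounded X f := by
      ext x; simp [RCLike.mul_im]
    simp only [h1, h2, map_add, map_sub, map_smul, smul_eq_mul, RingHom.id_apply,
      RCLike.ofReal_mul]
    nth_rw 5 [← RCLike.re_add_im c]
    rcases RCLike.I_mul_I (K := 𝕜) with h | h
    · simp only [h, mul_zero, zero_mul, add_zero]
      have : RCLike.im c = 0 := by rw [← RCLike.mul_im_I_ax c, h]; simp
      simp [this]
    · linear_combination -(RCLike.im c : 𝕜) *
        (m.toFun (RCLike.imCLM.compLeftContinuousBounded X f) : 𝕜) * h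

variable {𝕜}

theorem InvariantMean.extend_apply (m : InvariantMean G X) (f : X →ᵇ 𝕜) :
    m.extend 𝕜 f = (m.toFun (RCLike.reCLM.compLeftContinuousBounded X f) : 𝕜) +
      RCLike.I * (m.toFun (RCLike.imCLM.compLeftContinuousBounded X f) : 𝕜) := rfl

theorem InvariantMean.extend_translate (m : InvariantMean G X) (g : G) (f : X →ᵇ 𝕜) :
    m.extend 𝕜 (bddTranslate g f) = m.extend 𝕜 f := by
  rw [m.extend_apply f, ← m.map_translate g,
    ← m.map_translate g (RCLike.imCLM.compLeftContinuousBounded X f)]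
  rfl

theorem InvariantMean.extend_const (m : InvariantMean G X) (c : 𝕜) :
    m.extend 𝕜 (BoundedContinuousFunction.const X c) = c := by
  have h : ∀ t : ℝ, m.toFun (BoundedContinuousFunction.const X t) = t := fun t => by
    have : BoundedContinuousFunction.const X t = t • 1 := by ext x; simp
    rw [this, map_smul, m.map_one, smul_eq_mul, mul_one]
  have h1 : RCLike.reCLM.compLeftContinuousBounded X (BoundedContinuousFunction.const X c) =
    BoundedContinuousFunction.const X (RCLike.re c) := rfl
  have h2 : RCLike.imCLM.compLeftContinuousBounded X (BoundedContinuousFunction.const X c) =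
    BoundedContinuousFunction.const X (RCLike.im c) := rfl
  rw [extend_apply, h1, h2, h, h, mul_comm, RCLike.re_add_im]

/-- The factor `2` comes from estimating real and imaginary parts separately. -/
theorem InvariantMean.norm_extend_le (m : InvariantMean G X) (f : X →ᵇ 𝕜) {C : ℝ} (hC : 0 ≤ C)
    (hf : ∀ x, ‖f x‖ ≤ C) : ‖m.extend 𝕜 f‖ ≤ 2 * C := by
  have h1 : ‖RCLike.reCLM.compLeftContinuousBounded X f‖ ≤ C :=
    (BoundedContinuousFunction.norm_le hC).2 fun x => (RCLike.norm_re_le_norm _).trans (hf x)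
  have h2 : ‖RCLike.imCLM.compLeftContinuousBounded X f‖ ≤ C :=
    (BoundedContinuousFunction.norm_le hC).2 fun x => (RCLike.norm_im_le_norm _).trans (hf x)
  have hI : ‖(RCLike.I : 𝕜)‖ ≤ 1 := by
    rw [RCLike.norm_I]
    split_ifs <;> norm_num
  rw [extend_apply, two_mul]
  refine norm_add_le_of_le ?_ ?_
  · rw [RCLike.norm_ofReal]
    exact (m.norm_le _).trans h1
  · rw [norm_mul, RCLike.norm_ofReal]
    exact (mul_le_of_le_one_left (abs_nonneg _) hI).trans ((m.norm_le _).trans h2)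

end Extension

namespace BoundedCohomology

/-! ### The transfer -/

section Transfer

variable {𝕜 : Type*} [RCLike 𝕜] {G : Type*} [Group G] {F : Type*} [NormedAddCommGroup F]
  [NormedSpace 𝕜 F] (ρ : G →* (F ≃ₗᵢ[𝕜] F)) (H : Subgroup G)
  [TopologicalSpace (G ⧸ H)] [DiscreteTopology (G ⧸ H)]

/-- For an `H`-equivariant bounded map `c` with values in the dual module, this is the bounded
function `gH ↦ (g • c (g⁻¹ x)) y` on `G ⧸ H`. -/
noncomputable def transferFun {n : ℕ} (c : (Fin n → G) → StrongDual 𝕜 F) {C : ℝ}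
    (hC : ∀ x, ‖c x‖ ≤ C) (x : Fin n → G) (y : F) : (G ⧸ H) →ᵇ 𝕜 :=
  BoundedContinuousFunction.ofNormedAddCommGroupDiscrete
    (fun q => contragredient ρ q.out (c fun i => q.out⁻¹ * x i) y) (C * ‖y‖) fun q => by
      refine (ContinuousLinearMap.le_opNorm _ y).trans ?_
      rw [LinearIsometryEquiv.norm_map]
      gcongr
      exact hC _

variable {ρ H} {n : ℕ} {c : (Fin n → G) → StrongDual 𝕜 F} {C : ℝ}

theorem transferFun_mk (hC : ∀ x, ‖c x‖ ≤ C)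
    (hc : ∀ h ∈ H, ∀ x, c (fun i => h * x i) = contragredient ρ h (c x)) (x : Fin n → G) (y : F)
    (g : G) :
    transferFun ρ H c hC x y (g : G ⧸ H) = contragredient ρ g (c fun i => g⁻¹ * x i) y := by
  set k := (g : G ⧸ H).out with hk
  have hmem : k⁻¹ * g ∈ H := QuotientGroup.eq.1 (QuotientGroup.out_eq' (g : G ⧸ H))
  change contragredient ρ k (c fun i => k⁻¹ * x i) y = _
  have h1 : (fun i => k⁻¹ * x i) = fun i => (k⁻¹ * g) * (g⁻¹ * x i) := by
    funext i; group
  have h2 : ρ g⁻¹ y = ρ (k⁻¹ * g)⁻¹ (ρ k⁻¹ y) := by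
    change _ = (ρ (k⁻¹ * g)⁻¹ * ρ k⁻¹) y
    rw [← map_mul]
    group
  rw [h1, hc _ hmem, contragredient_apply, contragredient_apply, contragredient_apply, h2]

/-- The transfer: average the translates of an `H`-equivariant bounded map over `G ⧸ H`. The mean
is taken pointwise on the predual `F`. -/
noncomputable def transfer (m : InvariantMean G (G ⧸ H)) (hC : ∀ x, ‖c x‖ ≤ C)
    (x : Fin n → G) : StrongDual 𝕜 F :=
  LinearMap.mkContinuous
    { toFun := fun y => m.extend 𝕜 (transferFun ρ H c hC x y)
      map_add' := fun y z => by
        rw [← map_add]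
        congr 1
        ext q
        exact map_add (contragredient ρ q.out (c fun i => q.out⁻¹ * x i)) y z
      map_smul' := fun a y => by
        rw [RingHom.id_apply, ← map_smul]
        congr 1
        ext q
        exact map_smul (contragredient ρ q.out (c fun i => q.out⁻¹ * x i)) a y }
    (2 * C) fun y => by
      have hC0 : 0 ≤ C := (norm_nonneg _).trans (hC x)
      rw [mul_assoc]
      refine m.norm_extend_le _ (by positivity) fun q => ?_
      refine (ContinuousLinearMap.le_opNorm _ y).trans ?_
      rw [LinearIsometryEquiv.norm_map]
      gcongr
      exact hC _

theorem transfer_apply (m : InvariantMean G (G ⧸ H)) (hC : ∀ x, ‖c x‖ ≤ C) (x : Fin n → G)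
    (y : F) : transfer (ρ := ρ) m hC x y = m.extend 𝕜 (transferFun ρ H c hC x y) := rfl

theorem norm_transfer_le (m : InvariantMean G (G ⧸ H)) (hC : ∀ x, ‖c x‖ ≤ C) (x : Fin n → G) :
    ‖transfer (ρ := ρ) m hC x‖ ≤ 2 * C :=
  LinearMap.mkContinuous_norm_le _
    (mul_nonneg zero_le_two ((norm_nonneg _).trans (hC x))) _

theorem transfer_smul (m : InvariantMean G (G ⧸ H)) (hC : ∀ x, ‖c x‖ ≤ C)
    (hc : ∀ h ∈ H, ∀ x, c (fun i => h * x i) = contragredient ρ h (c x)) (g : G)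
    (x : Fin n → G) :
    transfer (ρ := ρ) m hC (fun i => g * x i) = contragredient ρ g (transfer (ρ := ρ) m hC x) := by
  ext y
  rw [contragredient_apply, transfer_apply, transfer_apply, ← m.extend_translate g]
  congr 1
  ext q
  induction q using QuotientGroup.induction_on with
  | H k =>
    change transferFun ρ H c hC (fun i => g * x i) y ((g * k : G) : G ⧸ H) = _
    rw [transferFun_mk hC hc, transferFun_mk hC hc]
    have h1 : (fun i => (g * k)⁻¹ * (g * x i)) = fun i => k⁻¹ * x i := by
      funext i; group
    rw [h1, contragredient_apply, contragredient_apply, mul_inv_rev, map_mul]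
    rfl

/-- The transfer is a cochain map and the identity on `G`-equivariant maps. -/
theorem augD_transfer (m : InvariantMean G (G ⧸ H)) (hC : ∀ x, ‖c x‖ ≤ C)
    (hc : ∀ h ∈ H, ∀ x, c (fun i => h * x i) = contragredient ρ h (c x))
    {f : (Fin (n + 1) → G) → StrongDual 𝕜 F} (hd : ∀ x, augD 𝕜 c x = f x)
    (hf : ∀ g x, f (fun i => g * x i) = contragredient ρ g (f x)) (x : Fin (n + 1) → G) :
    augD 𝕜 (transfer (ρ := ρ) m hC) x = f x := by
  ext y
  have h1 : augD 𝕜 (transfer (ρ := ρ) m hC) x y = m.extend 𝕜 (∑ i : Fin (n + 1),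
      (-1 : 𝕜) ^ (i : ℕ) • transferFun ρ H c hC (fun j => x (i.succAbove j)) y) := by
    rw [map_sum, augD, _root_.sum_apply]
    refine Finset.sum_congr rfl fun i _ => ?_
    rw [map_smul]
    rfl
  rw [h1, ← m.extend_const (f x y)]
  congr 1
  ext q
  induction q using QuotientGroup.induction_on with
  | H k =>
    have h2 : f x = contragredient ρ k (augD 𝕜 c fun i => k⁻¹ * x i) := by
      rw [hd, ← hf]
      simp
    rw [BoundedContinuousFunction.const_apply, h2, augD, map_sum,
      BoundedContinuousFunction.sum_apply]
    change _ = (∑ i, contragredient ρ k _) y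
    rw [_root_.sum_apply]
    refine Finset.sum_congr rfl fun i _ => ?_
    rw [BoundedContinuousFunction.smul_apply, transferFun_mk hC hc, map_smul]
    rfl

end Transfer

theorem res_injective_of_invariantMean {𝕜 : Type*} [RCLike 𝕜] {G : Type*} [Group G]
    {F : Type*} [NormedAddCommGroup F] [NormedSpace 𝕜 F] (ρ : G →* (F ≃ₗᵢ[𝕜] F))
    (H : Subgroup G) [TopologicalSpace (G ⧸ H)] [DiscreteTopology (G ⧸ H)]
    (m : InvariantMean G (G ⧸ H)) (n : ℕ) :
    Function.Injective (res (contragredient ρ) H n) := by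
  rw [injective_iff_map_eq_zero]
  intro z hz
  obtain ⟨⟨f, hf⟩, rfl⟩ := Submodule.Quotient.mk_surjective _ z
  rw [res, Submodule.mapQ_apply, Submodule.Quotient.mk_eq_zero] at hz
  rw [Submodule.Quotient.mk_eq_zero]
  change resCochain (contragredient ρ) H n f ∈ coboundaries _ n at hz
  change f ∈ coboundaries _ n
  cases n with
  | zero =>
    -- An equivariant map on `G` is determined by its value at `1`.
    have h0 : resCochain (contragredient ρ) H 0 f = 0 := hz
    have h1 : f.1 (fun _ => 1) = 0 := congrFun (congrArg Subtype.val h0) fun _ => 1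
    refine Cochain.ext fun x => ?_
    have h2 : x = fun i => x 0 * (fun _ => 1 : Fin 1 → G) i := by
      funext i
      rw [Fin.fin_one_eq_zero i, mul_one]
    rw [h2, f.2.2, h1, map_zero]
    rfl
  | succ n =>
    obtain ⟨b, hb⟩ := hz
    obtain ⟨c, ⟨C, hC⟩, hc, hd⟩ := exists_equivariant_primitive (contragredient ρ) H f hf b hb
    exact ⟨⟨transfer (ρ := ρ) m hC, ⟨2 * C, norm_transfer_le m hC⟩, transfer_smul m hC hc⟩,
      Cochain.ext (augD_transfer m hC hc hd f.2.2)⟩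

end BoundedCohomology

namespace BoundedCohomology

theorem exists_primitive_of_res_injective {𝕜 G V : Type*} [RCLike 𝕜] [Group G]
    [NormedAddCommGroup V] [NormedSpace 𝕜 V] {ρ : G →* (V ≃ₗᵢ[𝕜] V)} {H : Subgroup G} {n : ℕ}
    (hinj : Function.Injective (res ρ H (n + 1))) {f : Cochain ρ (n + 1)}
    (hf : d ρ (n + 1) f = 0) (hres : resCochain ρ H (n + 1) f = 0) : ∃ b, d ρ n b = f := by
  let z : cocycles ρ (n + 1) := ⟨f, hf⟩
  have hz : (Submodule.Quotient.mk z : Hb ρ (n + 1)) = 0 := by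
    apply hinj
    have h0 : resCocycles ρ H (n + 1) z = 0 := Subtype.ext hres
    rw [map_zero, res, Submodule.mapQ_apply, h0, Submodule.Quotient.mk_zero]
  exact (Submodule.Quotient.mk_eq_zero _).1 hz

/-! ### The point mass cocycle -/

section Universal

variable (𝕜 G X : Type*) [RCLike 𝕜] [Group G] [MulAction G X] [TopologicalSpace X]
  [DiscreteTopology X]

/-- The bounded functions `k` on `X × X` with `k (x, y) + k (y, z) = k (x, z)`. Every such function
is of the form `f y - f x`, so this is a model for the bounded functions on `X` modulo the
constants. -/
def differenceSubmodule : Submodule 𝕜 (X × X →ᵇ 𝕜) where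
  carrier := {k | ∀ x y z, k (x, y) + k (y, z) = k (x, z)}
  zero_mem' := by simp
  add_mem' := fun {k l} hk hl x y z => by
    simp only [BoundedContinuousFunction.add_apply, ← hk x y z, ← hl x y z]
    ring
  smul_mem' := fun a k hk x y z => by
    simp only [BoundedContinuousFunction.smul_apply, ← hk x y z, smul_add]

/-- The Banach space of bounded functions on `X` modulo the constants. -/
def Differences : Type _ := differenceSubmodule 𝕜 X

noncomputable instance : NormedAddCommGroup (Differences 𝕜 X) :=
  inferInstanceAs (NormedAddCommGroup (differenceSubmodule 𝕜 X))

noncomputable instance : NormedSpace 𝕜 (Differences 𝕜 X) :=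
  inferInstanceAs (NormedSpace 𝕜 (differenceSubmodule 𝕜 X))

instance : CompleteSpace (Differences 𝕜 X) := by
  refine IsClosed.completeSpace_coe (s := (differenceSubmodule 𝕜 X : Set (X × X →ᵇ 𝕜))) (hs := ?_)
  have : (differenceSubmodule 𝕜 X : Set (X × X →ᵇ 𝕜)) =
      ⋂ (x : X) (y : X) (z : X), {k | k (x, y) + k (y, z) = k (x, z)} := by
    ext k
    simp only [Set.mem_iInter]
    rfl
  rw [this]
  refine isClosed_iInter fun x => isClosed_iInter fun y => isClosed_iInter fun z => ?_
  have e := fun p : X × X => (BoundedContinuousFunction.evalCLM 𝕜 (β := 𝕜) p).continuous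
  exact isClosed_eq ((e _).add (e _)) (e _)

variable {𝕜} in
theorem Differences.ext {X : Type*} [TopologicalSpace X] {k l : Differences 𝕜 X}
    (h : ∀ x y, k.1 (x, y) = l.1 (x, y)) : k = l :=
  Subtype.ext (BoundedContinuousFunction.ext fun p => h p.1 p.2)

/-- Evaluation at `(x, y)`, that is, the difference of the point masses at `y` and `x`. -/
noncomputable def evalDiff {X : Type*} [TopologicalSpace X] (x y : X) :
    StrongDual 𝕜 (Differences 𝕜 X) :=
  (BoundedContinuousFunction.evalCLM 𝕜 (x, y)).comp (differenceSubmodule 𝕜 X).subtypeL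

variable {𝕜} in
theorem evalDiff_apply {X : Type*} [TopologicalSpace X] (x y : X)
    (k : Differences 𝕜 X) : evalDiff 𝕜 x y k = k.1 (x, y) := rfl

variable {𝕜 G X}

theorem norm_bddTranslate {Y : Type*} [MulAction G Y] [TopologicalSpace Y] [DiscreteTopology Y]
    (g : G) (f : Y →ᵇ 𝕜) : ‖bddTranslate g f‖ = ‖f‖ := by
  have key : ∀ (g : G) (f : Y →ᵇ 𝕜), ‖bddTranslate g f‖ ≤ ‖f‖ := fun g f =>
    (BoundedContinuousFunction.norm_le (norm_nonneg f)).2 fun x => f.norm_coe_le_norm (g • x)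
  refine le_antisymm (key g f) ?_
  have h : f = bddTranslate g⁻¹ (bddTranslate g f) := by ext x; simp
  exact (congrArg norm h).le.trans (key _ _)

variable (𝕜 G X) in
/-- The isometric action of `G` on `Differences 𝕜 X` by left translation. -/
def translationAction : G →* (Differences 𝕜 X ≃ₗᵢ[𝕜] Differences 𝕜 X) where
  toFun g :=
    { toFun := fun k => ⟨bddTranslate g⁻¹ k.1, fun x y z => k.2 _ _ _⟩
      invFun := fun k => ⟨bddTranslate g k.1, fun x y z => k.2 _ _ _⟩
      map_add' := fun _ _ => rfl
      map_smul' := fun _ _ => rfl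
      left_inv := fun k => Differences.ext fun x y => by
        change k.1 (g⁻¹ • g • x, g⁻¹ • g • y) = _
        rw [inv_smul_smul, inv_smul_smul]
      right_inv := fun k => Differences.ext fun x y => by
        change k.1 (g • g⁻¹ • x, g • g⁻¹ • y) = _
        rw [smul_inv_smul, smul_inv_smul]
      norm_map' := fun k => norm_bddTranslate g⁻¹ k.1 }
  map_one' := LinearIsometryEquiv.ext fun k => Differences.ext fun x y => by
    change k.1 ((1 : G)⁻¹ • x, (1 : G)⁻¹ • y) = k.1 (x, y)
    rw [inv_one, one_smul, one_smul]
  map_mul' g h := LinearIsometryEquiv.ext fun k => Differences.ext fun x y => by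
    change k.1 ((g * h)⁻¹ • x, (g * h)⁻¹ • y) = k.1 (h⁻¹ • g⁻¹ • x, h⁻¹ • g⁻¹ • y)
    rw [mul_inv_rev, mul_smul, mul_smul]

theorem translationAction_apply (g : G) (k : Differences 𝕜 X) (x y : X) :
    (translationAction 𝕜 G X g k).1 (x, y) = k.1 (g⁻¹ • x, g⁻¹ • y) := rfl

variable (𝕜 G) in
/-- The `1`-cocycle `(g₀, g₁) ↦ δ_{g₁ x₀} - δ_{g₀ x₀}`. -/
noncomputable def pointMassCochain (x₀ : X) :
    Cochain (contragredient (translationAction 𝕜 G X)) 1 :=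
  ⟨fun g => evalDiff 𝕜 (g 0 • x₀) (g 1 • x₀), ⟨1, fun g =>
    ContinuousLinearMap.opNorm_le_bound _ zero_le_one fun k => by
      rw [one_mul]
      exact k.1.norm_coe_le_norm _⟩, fun g x => by
    ext k
    rw [contragredient_apply, evalDiff_apply, evalDiff_apply, translationAction_apply, inv_inv,
      mul_smul, mul_smul]⟩

theorem pointMassCochain_apply (x₀ : X) (g : Fin 2 → G) :
    (pointMassCochain 𝕜 G x₀).1 g = evalDiff 𝕜 (g 0 • x₀) (g 1 • x₀) := rfl

theorem d_pointMassCochain (x₀ : X) :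
    d (contragredient (translationAction 𝕜 G X)) 1 (pointMassCochain 𝕜 G x₀) = 0 := by
  refine Cochain.ext fun g => ?_
  change _ = (0 : StrongDual 𝕜 (Differences 𝕜 X))
  ext k
  rw [d_apply, Fin.sum_univ_three]
  have h := k.2 (g 0 • x₀) (g 1 • x₀) (g 2 • x₀)
  have e1 : (1 : Fin 3).succAbove 1 = 2 := rfl
  have e2 : (2 : Fin 3).succAbove 1 = 1 := rfl
  have e3 : (2 : Fin 3).succAbove 0 = 0 := rfl
  have e4 : (1 : Fin 3).succAbove 0 = 0 := rfl
  simp [pointMassCochain_apply, evalDiff_apply, ← h, e1, e2, e3, e4]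

/-- The function `(x, y) ↦ f y - f x`. -/
noncomputable def diffOf (f : X →ᵇ ℝ) : Differences 𝕜 X :=
  ⟨BoundedContinuousFunction.ofNormedAddCommGroupDiscrete
    (fun p => ((f p.2 - f p.1 : ℝ) : 𝕜)) (2 * ‖f‖) fun p => by
      rw [RCLike.norm_ofReal, two_mul]
      exact norm_sub_le_of_le (f.norm_coe_le_norm _) (f.norm_coe_le_norm _),
    fun x y z => by
      change ((f y - f x : ℝ) : 𝕜) + ((f z - f y : ℝ) : 𝕜) = ((f z - f x : ℝ) : 𝕜)
      push_cast
      ring⟩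

theorem diffOf_apply (f : X →ᵇ ℝ) (x y : X) :
    (diffOf f : Differences 𝕜 X).1 (x, y) = ((f y - f x : ℝ) : 𝕜) := rfl

theorem norm_diffOf_le (f : X →ᵇ ℝ) : ‖(diffOf f : Differences 𝕜 X)‖ ≤ 2 * ‖f‖ :=
  (BoundedContinuousFunction.norm_le (by positivity)).2 fun p => by
    change ‖((f p.2 - f p.1 : ℝ) : 𝕜)‖ ≤ _
    rw [RCLike.norm_ofReal, two_mul]
    exact norm_sub_le_of_le (f.norm_coe_le_norm _) (f.norm_coe_le_norm _)

theorem diffOf_add (f k : X →ᵇ ℝ) :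
    (diffOf (f + k) : Differences 𝕜 X) = diffOf f + diffOf k := by
  refine Differences.ext fun x y => ?_
  change ((f y + k y - (f x + k x) : ℝ) : 𝕜) =
    ((f y - f x : ℝ) : 𝕜) + ((k y - k x : ℝ) : 𝕜)
  push_cast
  ring

theorem diffOf_smul (a : ℝ) (f : X →ᵇ ℝ) :
    (diffOf (a • f) : Differences 𝕜 X) = (a : 𝕜) • diffOf f := by
  refine Differences.ext fun x y => ?_
  change ((a * f y - a * f x : ℝ) : 𝕜) = (a : 𝕜) * ((f y - f x : ℝ) : 𝕜)
  push_cast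
  ring

theorem diffOf_one : (diffOf (1 : X →ᵇ ℝ) : Differences 𝕜 X) = 0 := by
  refine Differences.ext fun x y => ?_
  change (((1 : ℝ) - 1 : ℝ) : 𝕜) = 0
  simp

theorem diffOf_bddTranslate (g : G) (f : X →ᵇ ℝ) :
    (diffOf (bddTranslate g f) : Differences 𝕜 X) =
      translationAction 𝕜 G X g⁻¹ (diffOf f) := by
  refine Differences.ext fun x y => ?_
  rw [translationAction_apply, diffOf_apply, diffOf_apply, inv_inv]
  rfl

/-- The functional `δ_{x₀} - φ` on the bounded real functions, where `φ` is a functional on the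
bounded functions modulo the constants. It is normalized. -/
noncomputable def pointMassSub (x₀ : X) (φ : StrongDual 𝕜 (Differences 𝕜 X)) :
    (X →ᵇ ℝ) →L[ℝ] ℝ :=
  LinearMap.mkContinuous
    { toFun := fun f => f x₀ - RCLike.re (φ (diffOf f))
      map_add' := fun f k => by
        rw [diffOf_add, map_add, map_add, BoundedContinuousFunction.add_apply]
        ring
      map_smul' := fun a f => by
        rw [diffOf_smul, map_smul, smul_eq_mul, RCLike.re_ofReal_mul,
          BoundedContinuousFunction.smul_apply, RingHom.id_apply, smul_eq_mul, smul_eq_mul,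
          mul_sub] }
    (1 + ‖φ‖ * 2) fun f => by
      rw [add_mul, one_mul, mul_assoc]
      refine norm_sub_le_of_le (f.norm_coe_le_norm _) ((RCLike.norm_re_le_norm _).trans ?_)
      exact (φ.le_opNorm _).trans (mul_le_mul_of_nonneg_left (norm_diffOf_le f) (norm_nonneg _))

theorem pointMassSub_apply (x₀ : X) (φ : StrongDual 𝕜 (Differences 𝕜 X)) (f : X →ᵇ ℝ) :
    pointMassSub x₀ φ f = f x₀ - RCLike.re (φ (diffOf f)) := rfl

/-- A primitive `b` of the point mass cocycle makes `δ_{g x₀} - b g` independent of `g`, hence a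
`G`-invariant functional on the bounded functions. -/
theorem nonempty_invariantMean_of_primitive (x₀ : X)
    (b : Cochain (contragredient (translationAction 𝕜 G X)) 0)
    (hb : d (contragredient (translationAction 𝕜 G X)) 0 b = pointMassCochain 𝕜 G x₀) :
    Nonempty (InvariantMean G X) := by
  let β : G → StrongDual 𝕜 (Differences 𝕜 X) := fun g => b.1 fun _ => g
  have hβ : ∀ g h k, β (g * h) k = β h (translationAction 𝕜 G X g⁻¹ k) := fun g h k => by
    rw [← contragredient_apply]
    exact congrFun (congrArg DFunLike.coe (b.2.2 g fun _ => h)) k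
  have hd : ∀ g h k, β h k - β g k = k.1 (g • x₀, h • x₀) := fun g h k => by
    have h1 := congrFun (congrArg DFunLike.coe (congrFun (congrArg Subtype.val hb) ![g, h])) k
    rw [d_apply, Fin.sum_univ_two, pointMassCochain_apply, evalDiff_apply] at h1
    have e0 : (fun j : Fin 1 => ![g, h] ((0 : Fin 2).succAbove j)) = fun _ => h := by
      funext j; rw [Fin.fin_one_eq_zero j]; rfl
    have e1 : (fun j : Fin 1 => ![g, h] ((1 : Fin 2).succAbove j)) = fun _ => g := by
      funext j; rw [Fin.fin_one_eq_zero j]; rfl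
    rw [e0, e1] at h1
    simpa [β, sub_eq_add_neg] using h1
  have hμ : ∀ (g : G) f, pointMassSub x₀ (β 1) f = pointMassSub (g • x₀) (β g) f := fun g f => by
    have h1 := congrArg RCLike.re (hd 1 g (diffOf f))
    rw [diffOf_apply, RCLike.ofReal_re, map_sub, one_smul] at h1
    rw [pointMassSub_apply, pointMassSub_apply]
    linarith
  refine InvariantMean.nonempty_of_functional (G := G) (pointMassSub x₀ (β 1)) ?_ fun g f => ?_
  · rw [pointMassSub_apply, diffOf_one, map_zero, map_zero, sub_zero]
    rfl
  · rw [hμ g f, pointMassSub_apply, pointMassSub_apply, diffOf_bddTranslate, ← hβ, mul_one,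
      bddTranslate_apply]

theorem nonempty_invariantMean_of_res_injective (H : Subgroup G) (x₀ : X)
    (hx₀ : ∀ h ∈ H, h • x₀ = x₀)
    (hinj : Function.Injective (res (contragredient (translationAction 𝕜 G X)) H 1)) :
    Nonempty (InvariantMean G X) := by
  obtain ⟨b, hb⟩ := exists_primitive_of_res_injective hinj (d_pointMassCochain x₀) <|
    Cochain.ext fun g => by
      change evalDiff 𝕜 ((g 0 : G) • x₀) ((g 1 : G) • x₀) = 0
      rw [hx₀ _ (g 0).2, hx₀ _ (g 1).2]
      ext k
      have h0 : k.1 (x₀, x₀) = 0 := by simpa using k.2 x₀ x₀ x₀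
      exact h0
  exact nonempty_invariantMean_of_primitive x₀ b hb

end Universal

end BoundedCohomology

/-! ### The equivalence -/

theorem mainTheorem5 (𝕜 : Type) [RCLike 𝕜] {G : Type u} [Group G] (H : Subgroup G) :
    IsCoamenable.{u, max u v} H ↔
      ∀ (F : Type (max u w)) [NormedAddCommGroup F] [NormedSpace 𝕜 F] [CompleteSpace F]
        (ρ : G →* (F ≃ₗᵢ[𝕜] F)) (n : ℕ),
        Function.Injective
          (BoundedCohomology.res (BoundedCohomology.contragredient ρ) H n) := by
  let _ : TopologicalSpace (G ⧸ H) := ⊥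
  have : DiscreteTopology (G ⧸ H) := ⟨rfl⟩
  constructor
  · intro h F _ _ _ ρ n
    obtain ⟨m⟩ := IsCoamenable.nonempty_invariantMean.{u, v} h
    exact BoundedCohomology.res_injective_of_invariantMean ρ H m n
  · intro h
    -- The lift places the coefficient module in the universe over which `F` ranges.
    let X := ULift.{w} (G ⧸ H)
    let _ : TopologicalSpace X := ⊥
    have : DiscreteTopology X := ⟨rfl⟩
    obtain ⟨m⟩ := BoundedCohomology.nonempty_invariantMean_of_res_injective (𝕜 := 𝕜) H
      (ULift.up ((1 : G) : G ⧸ H) : X) (fun g hg => congrArg ULift.up <| by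
        change ((g * 1 : G) : G ⧸ H) = ((1 : G) : G ⧸ H)
        rw [QuotientGroup.eq]
        simpa using hg)
      (h (BoundedCohomology.Differences 𝕜 X) (BoundedCohomology.translationAction 𝕜 G X) 1)
    exact isCoamenable_of_invariantMean H (m.map ULift.down fun _ _ => rfl)
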